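/- **Setting.** Let $F(\mathbf{x})$ be a symmetric $m\times m$ matrix and $G(\mathbf{x})$ a symmetric $q\times q$ matrix of real polynomials in $\mathbf{x}=(x_1,\dots,x_n)$. The degree of a polynomial matrix is the largest total degree of its entries. Let $\mathcal{X}=\{\mathbf{x}\in\mathbb{R}^n : G(\mathbf{x})\succeq 0\}$ and $$\lambda^\star=\inf_{\mathbf{x}\in\mathcal{X}}\lambda_{\min}(F(\mathbf{x})),$$ where $\lambda_{\min}$ is the smallest eigenvalue. Put $d_G=\lceil\deg(G)/2\rceil$ and $\delta=\max\{1,d_G\}$ (so $\delta=d_G$ unless $G$ is constant). For a family $\mathbf{S}=(S_\alpha)$ of symmetric real $m\times m$ matrices indexed by $\alpha\in\mathbb{N}^n$, $|\alpha|\le 2k$, let $M_d(\mathbf{S})$ be the block matrix with blocks $S_{\alpha+\beta}$, $|\alpha|,|\beta|\le d$, and $M_d(G\mathbf{S})$ the block matrix with blocks $\sum_\gamma S_{\alpha+\beta+\gamma}\otimes G_\gamma$, $|\alpha|,|\beta|\le d$, where $G=\sum_\gamma G_\gamma\mathbf{x}^\gamma$. Let $\mathscr{L}_{\mathbf{S}}(F)=\sum_\alpha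 \mathrm{tr}(F_\alpha S_\alpha)$ for $F=\sum_\alpha F_\alpha\mathbf{x}^\alpha$. For $k\ge\max\{\lceil\deg(F)/2\rceil,\lceil\deg(G)/2\rceil\}$ consider the relaxation $$\lambda_k^{\rm primal}=\inf\{\mathscr{L}_{\mathbf{S}}(F) : \mathbf{S}=(S_\alpha)_{|\alpha|\le 2k},\ M_k(\mathbf{S})\succeq0,\ M_{k-d_G}(G\mathbf{S})\succeq 0,\ \mathscr{L}_{\mathbf{S}}(I_m)=1\}.$$ A family $(S_\alpha)_{|\alpha|\le N}$ has *representing measure* $\Phi$ on $\mathcal{X}$ if $\Phi=[\phi_{ij}]$ is a symmetric $m\times m$ matrix of finite signed Borel measures on $\mathcal{X}$ with $\Phi(A)\succeq0$ for all Borel $A\subseteq\mathcal{X}$, and $S_\alpha=\int_{\mathcal{X}}\mathbf{x}^\alpha\,d\Phi(\mathbf{x})$ for all $|\alpha|\le N$. **Theorem.** Let $\mathbf{S}^\star_k$ be an optimal solution of the relaxation of order $k$, and suppose that the flat extension condition $$\mathrm{rank}\,M_t(\mathbf{S}^\star_k)=\mathrm{rank}\,M_{t-\delta}(\mathbf{S}^\star_k)$$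 holds for some integer $t$ with $\lceil\max\{\deg F,\deg G\}/2\rceil\le t\le k$ and $t\ge\delta$. Then: 1. The truncation $(S^\star_{k,\alpha})_{|\alpha|\le 2t}$ (which is $\mathbf{S}^\star_k$ itself if $t=k$) has a representing measure $\Phi^\star=\sum_{i=1}^r W_i\delta_{\mathbf{x}^{(i)}}$ with distinct points $\mathbf{x}^{(i)}\in\mathcal{X}$, nonzero positive semidefinite matrices $W_i$, and $\sum_{i=1}^r\mathrm{tr}\,W_i=1$. 2. $\lambda^\star$ is finite, and $\lambda_k^{\rm primal}=\lambda^\star$. 3. Let $\sum_{i=1}^r W_i\delta_{\mathbf{x}^{(i)}}$, with distinct $\mathbf{x}^{(i)}\in\mathcal{X}$ and $W_i\succeq 0$, be any representing measure of that truncation. For every decomposition $W_i=\sum_{l=1}^{m_i}\mathbf{v}^{(i,l)}(\mathbf{v}^{(i,l)})^{\intercal}$, $\mathbf{v}^{(i,l)}\in\mathbb{R}^m$, $i=1,\dots,r$, one has $F(\mathbf{x}^{(i)})\mathbf{v}^{(i,l)}=\lambda^\star\mathbf{v}^{(i,l)}$ for all $l$ and $i$; and $\lambda_{\min}(F(\mathbf{x}^{(i)}))=\lambda^\star$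 whenever $W_i\ne0$. -/

import Mathlib

noncomputable section

namespace EigMoment

/-! ### Polynomial matrices -/

/-- `a × b` matrices with entries in `ℝ[x₁, …, xₙ]`. -/
abbrev PolyMat (n a b : ℕ) : Type := Matrix (Fin a) (Fin b) (MvPolynomial (Fin n) ℝ)

/-- The value `T(x)`. -/
def evalAt {n a b : ℕ} (T : PolyMat n a b) (x : Fin n → ℝ) : Matrix (Fin a) (Fin b) ℝ :=
  T.map (MvPolynomial.eval x)

/-- The coefficient matrix `T_γ` of the monomial `x^γ`. -/
def coeffMat {n a b : ℕ} (T : PolyMat n a b) (γ : Fin n →₀ ℕ) : Matrix (Fin a) (Fin b) ℝ :=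
  T.map (MvPolynomial.coeff γ)

/-- `supp T`: the exponents of the monomials that appear in some entry of `T`. -/
def supp {n a b : ℕ} (T : PolyMat n a b) : Finset (Fin n →₀ ℕ) :=
  Finset.univ.biUnion fun i => Finset.univ.biUnion fun j => (T i j).support

/-- `deg T`: the largest total degree of an entry of `T`. -/
def deg {n a b : ℕ} (T : PolyMat n a b) : ℕ :=
  Finset.univ.sup fun i => Finset.univ.sup fun j => (T i j).totalDegree

/-- `⌈deg T / 2⌉`; for the constraint matrix `G` this is `d_G`. -/
def halfDeg {n a b : ℕ} (T : PolyMat n a b) : ℕ := (deg T + 1) / 2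

/-- `𝒳 = {x ∈ ℝⁿ ∣ G(x) ⪰ 0}`. -/
def feasibleSet {n q : ℕ} (G : PolyMat n q q) : Set (Fin n → ℝ) :=
  {x | (evalAt G x).PosSemidef}

/-! ### Minimizing the smallest eigenvalue -/

/-- The smallest eigenvalue of a real symmetric matrix. -/
def lamMin {m : ℕ} (A : Matrix (Fin m) (Fin m) ℝ) : ℝ := sInf (spectrum ℝ A)

/-- `λ* = inf {λ_min(F(x)) ∣ x ∈ 𝒳}`, an extended real number (`⊤` if `𝒳` is empty). -/
def lamStar {n m q : ℕ} (F : PolyMat n m m) (G : PolyMat n q q) : EReal :=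
  ⨅ x ∈ feasibleSet G, ((lamMin (evalAt F x) : ℝ) : EReal)

/-! ### Matrix-valued sequences, moment matrices and localizing matrices -/

/-- Families `(S_α)` of real `m × m` matrices indexed by `α ∈ ℕⁿ`. A sequence truncated at order `N`
is given by any such family, of which only the `S_α` with `|α| ≤ N` are ever used. -/
abbrev MatSeq (n m : ℕ) : Type := (Fin n →₀ ℕ) → Matrix (Fin m) (Fin m) ℝ

/-- `ℕⁿ_d = {α ∈ ℕⁿ ∣ |α| ≤ d}`. -/
abbrev MultiIdx (n d : ℕ) : Type := {α : Fin n →₀ ℕ // α.degree ≤ d}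

instance instFintypeMultiIdx (n d : ℕ) : Fintype (MultiIdx n d) :=
  (Finsupp.finite_of_degree_le (σ := Fin n) d).fintype

/-- The Riesz functional `ℒ_S(F) = ∑_{α ∈ supp F} tr(F_α S_α)`. -/
def riesz {n m : ℕ} (S : MatSeq n m) (F : PolyMat n m m) : ℝ :=
  ∑ α ∈ supp F, (coeffMat F α * S α).trace

/-- The moment matrix `M_d(S)`, with `(α, β)`-block `S_{α+β}`, `α, β ∈ ℕⁿ_d`. -/
def momentMat {n m : ℕ} (d : ℕ) (S : MatSeq n m) :
    Matrix (MultiIdx n d × Fin m) (MultiIdx n d × Fin m) ℝ :=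
  Matrix.of fun r c => S (r.1.1 + c.1.1) r.2 c.2

/-- The localizing matrix `M_d(G S)`, with `(α, β)`-block `∑_{γ ∈ supp G} S_{α+β+γ} ⊗ G_γ`,
`α, β ∈ ℕⁿ_d`. -/
def localizingMat {n m q : ℕ} (d : ℕ) (G : PolyMat n q q) (S : MatSeq n m) :
    Matrix (MultiIdx n d × (Fin m × Fin q)) (MultiIdx n d × (Fin m × Fin q)) ℝ :=
  Matrix.of fun r c =>
    (∑ γ ∈ supp G, Matrix.kronecker (S (r.1.1 + c.1.1 + γ)) (coeffMat G γ)) r.2 c.2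

/-- The cone `ℳ_k^m(G)` of sequences `(S_α)_{|α| ≤ 2k}` of symmetric matrices with `M_k(S) ⪰ 0` and
`M_{k-d_G}(G S) ⪰ 0` (used for `k ≥ d_G`). -/
def momentCone {n m q : ℕ} (k : ℕ) (G : PolyMat n q q) : Set (MatSeq n m) :=
  {S | (∀ α : Fin n →₀ ℕ, α.degree ≤ 2 * k → (S α).IsSymm) ∧
    (momentMat k S).PosSemidef ∧ (localizingMat (k - halfDeg G) G S).PosSemidef}

/-- Feasible points of the `k`-th moment relaxation: `S ∈ ℳ_k^m(G)` with `ℒ_S(I_m) = 1`. -/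
def relaxFeasible {n m q : ℕ} (k : ℕ) (G : PolyMat n q q) : Set (MatSeq n m) :=
  {S | S ∈ momentCone k G ∧ riesz S (1 : PolyMat n m m) = 1}

/-- The optimal value `λ_k^primal = inf {ℒ_S(F) ∣ S ∈ ℳ_k^m(G), ℒ_S(I_m) = 1}` of the `k`-th moment
relaxation, an extended real number. -/
def lamPrimal {n m q : ℕ} (k : ℕ) (F : PolyMat n m m) (G : PolyMat n q q) : EReal :=
  ⨅ S ∈ relaxFeasible (m := m) k G, ((riesz S F : ℝ) : EReal)

/-- `S` is an optimal solution to the `k`-th moment relaxation. -/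
def IsOptimal {n m q : ℕ} (k : ℕ) (F : PolyMat n m m) (G : PolyMat n q q) (S : MatSeq n m) : Prop :=
  S ∈ relaxFeasible k G ∧ ∀ S' ∈ relaxFeasible (m := m) k G, riesz S F ≤ riesz S' F

/-- The drop in order in the flat extension condition: `d_G`, but at least `1`, so that the condition
is not void for a constant `G`. -/
def flatStep {n q : ℕ} (G : PolyMat n q q) : ℕ := max 1 (halfDeg G)

/-- The flat extension condition at order `t`, for a sequence truncated at order `2k`:
`⌈max{deg F, deg G}/2⌉ ≤ t ≤ k` and `rank M_t(S) = rank M_{t-d_G}(S)`. -/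
def FlatAt {n m q : ℕ} (k t : ℕ) (F : PolyMat n m m) (G : PolyMat n q q) (S : MatSeq n m) : Prop :=
  (max (deg F) (deg G) + 1) / 2 ≤ t ∧ t ≤ k ∧ flatStep G ≤ t ∧
    (momentMat t S).rank = (momentMat (t - flatStep G) S).rank

/-! ### Matrix-valued measures -/

/-- `m × m` matrices `Φ = [φ_ij]` of finite signed Borel measures on `X ⊆ ℝⁿ`. -/
abbrev MatMeasure {n : ℕ} (m : ℕ) (X : Set (Fin n → ℝ)) : Type :=
  Matrix (Fin m) (Fin m) (MeasureTheory.SignedMeasure X)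

/-- `Φ ∈ 𝔐^m_+(X)`: `Φ` is symmetric and `Φ(A) ⪰ 0` for every Borel set `A ⊆ X`. -/
def MatMeasure.IsPSD {n m : ℕ} {X : Set (Fin n → ℝ)} (Φ : MatMeasure m X) : Prop :=
  Φ.IsSymm ∧ ∀ A : Set X, MeasurableSet A → (Matrix.of fun i j => Φ i j A).PosSemidef

/-- `Φ` is a representing measure of the truncated sequence `(S_α)_{|α| ≤ N}`:
`Φ ∈ 𝔐^m_+(X)`, and `S_α = ∫_X x^α dΦ(x)` (entrywise, the integrals being finite). -/
def MatMeasure.Represents {n m : ℕ} {X : Set (Fin n → ℝ)} (Φ : MatMeasure m X) (N : ℕ)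
    (S : MatSeq n m) : Prop :=
  Φ.IsPSD ∧ ∀ α : Fin n →₀ ℕ, α.degree ≤ N → ∀ i j : Fin m,
    (Φ i j).Integrable (fun x : X => ∏ l, x.1 l ^ α l) ∧
    S α i j = (Φ i j).integral (fun x : X => ∏ l, x.1 l ^ α l) (ContinuousLinearMap.lsmul ℝ ℝ)

/-- The matrix-valued measure `∑_i W_i δ_{x⁽ⁱ⁾}`. -/
def atomicMeasure {n m r : ℕ} {X : Set (Fin n → ℝ)} (x : Fin r → X)
    (W : Fin r → Matrix (Fin m) (Fin m) ℝ) : MatMeasure m X :=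
  Matrix.of fun a b => ∑ i, MeasureTheory.VectorMeasure.dirac (x i) (W i a b)

end EigMoment

end

open EigMoment

namespace EigMoment

open scoped InnerProductSpace

/-! ### Symmetric matrices and the smallest eigenvalue -/

/-! The measure comes from a finite-dimensional GNS construction. Factor `M_t(S) = BᵀB`; its columns
are Gram vectors `g α a` with `⟪g α a, g β b⟫ = S (α + β) a b`. Flatness says that those of degree
at most `t - δ` already span. Since inner products depend only on `α + β`, multiplication by `x_l`,
`g α a ↦ g (α + e_l) a`, is a well-defined symmetric operator on this span, and these operators
commute. A joint orthonormal eigenbasis `b i` with eigenvalues `y i`, together with Parseval, gives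
`S_α = ∑ (y i)^α w_i w_iᵀ` for `|α| ≤ 2t`, where `w_i a = ⟪g 0 a, b i⟫`
(`exists_rankOne_atoms_of_flat`).

Each `b i` is a combination of Gram vectors of degree at most `t - δ`, that is, a vector polynomial
separating atom `i` from the others. Testing the localizing matrix on this polynomial tensored with
`u` leaves `uᵀ G(y i) u ≥ 0`, so the atoms lie in the feasible set
(`posSemidef_evalAt_of_localizingMat`).

For optimality, a point of `𝒳` with a unit eigenvector for `λ_min` gives a feasible sequence, so
`ℒ_S(F) ≤ λ_min(F(y))` on `𝒳`. Conversely `ℒ_S(F) = ∑ tr(F(x_i) W_i) ≥ ∑ λ_min(F(x_i)) tr W_i ≥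
ℒ_S(F)`, because `∑ tr W_i = 1`. Every inequality is therefore an equality, atom by atom
(`trace_mul_eq_of_isOptimal`), which yields the value and the eigenvectors. -/

theorem exists_gram_of_posSemidef {ι : Type*} [Fintype ι] {A : Matrix ι ι ℝ}
    (hA : A.PosSemidef) : ∃ B : Matrix ι ι ℝ, A = B.conjTranspose * B := by
  classical
  open scoped MatrixOrder in
  obtain ⟨B, hB⟩ := CStarAlgebra.nonneg_iff_eq_star_mul_self.mp hA.nonneg
  exact ⟨B, hB⟩

theorem exists_eigenvalue_eq_lamMin {m : ℕ} [Nonempty (Fin m)] {A : Matrix (Fin m) (Fin m) ℝ}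
    (hA : A.IsHermitian) : ∃ i, hA.eigenvalues i = lamMin A := by
  have h : sInf (Set.range hA.eigenvalues) ∈ Set.range hA.eigenvalues :=
    (Set.range_nonempty _).csInf_mem (Set.finite_range _)
  rw [lamMin, hA.spectrum_real_eq_range_eigenvalues]
  exact h

theorem lamMin_le_of_mem_spectrum {m : ℕ} {A : Matrix (Fin m) (Fin m) ℝ}
    (hA : A.IsHermitian) {c : ℝ} (hc : c ∈ spectrum ℝ A) : lamMin A ≤ c := by
  refine csInf_le ?_ hc
  rw [hA.spectrum_real_eq_range_eigenvalues]
  exact (Set.finite_range _).bddBelow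

theorem posSemidef_sub_lamMin {m : ℕ} {A : Matrix (Fin m) (Fin m) ℝ} (hA : A.IsHermitian) :
    (A - lamMin A • (1 : Matrix (Fin m) (Fin m) ℝ)).PosSemidef := by
  rw [Matrix.posSemidef_iff_isHermitian_and_spectrum_nonneg]
  refine ⟨hA.sub (by simp [Matrix.IsHermitian]), fun c hc => ?_⟩
  rw [← Algebra.algebraMap_eq_smul_one, ← spectrum.sub_singleton_eq] at hc
  obtain ⟨d, hd, e, he, rfl⟩ := hc
  rw [Set.mem_singleton_iff] at he
  subst he
  exact sub_nonneg.mpr (lamMin_le_of_mem_spectrum hA hd)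

/-- With `W = BᵀB`, the difference of the two sides is the trace of the positive semidefinite matrix
`B (A - λ_min I) Bᵀ`. -/
theorem lamMin_mul_trace_le {m : ℕ} {A W : Matrix (Fin m) (Fin m) ℝ} (hA : A.IsHermitian)
    (hW : W.PosSemidef) : lamMin A * W.trace ≤ (A * W).trace := by
  obtain ⟨B, rfl⟩ := exists_gram_of_posSemidef hW
  have h := ((posSemidef_sub_lamMin hA).mul_mul_conjTranspose_same B).trace_nonneg
  rw [Matrix.mul_assoc, Matrix.trace_mul_comm, Matrix.mul_assoc, Matrix.sub_mul,
    Matrix.trace_sub, Matrix.smul_mul, Matrix.one_mul, Matrix.trace_smul, smul_eq_mul] at h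
  linarith

theorem exists_unit_eigenvector_lamMin {m : ℕ} [Nonempty (Fin m)] {A : Matrix (Fin m) (Fin m) ℝ}
    (hA : A.IsHermitian) :
    ∃ v : Fin m → ℝ, v ⬝ᵥ v = 1 ∧ A.mulVec v = lamMin A • v := by
  obtain ⟨i, hi⟩ := exists_eigenvalue_eq_lamMin hA
  refine ⟨hA.eigenvectorBasis i, ?_, by rw [hA.mulVec_eigenvectorBasis, hi]⟩
  have h := hA.eigenvectorBasis.orthonormal.1 i
  rw [EuclideanSpace.norm_eq, Real.sqrt_eq_one] at h
  simpa [dotProduct, sq] using h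

/-- A vector on which a shifted positive semidefinite form vanishes is an eigenvector. -/
theorem mulVec_eq_smul_of_posSemidef_sub {m : ℕ} {A : Matrix (Fin m) (Fin m) ℝ} {c : ℝ}
    (hA : (A - c • (1 : Matrix (Fin m) (Fin m) ℝ)).PosSemidef) {v : Fin m → ℝ}
    (hv : v ⬝ᵥ (A - c • (1 : Matrix (Fin m) (Fin m) ℝ)).mulVec v = 0) :
    A.mulVec v = c • v := by
  have h := (hA.dotProduct_mulVec_zero_iff v).mp (by simpa using hv)
  rw [Matrix.sub_mulVec, Matrix.smul_mulVec, Matrix.one_mulVec, sub_eq_zero] at h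
  exact h

/-! ### Commuting symmetric operators -/

/-- A symmetric partial assignment `g i ↦ h i` on a spanning family extends to a symmetric
operator. -/
theorem exists_isSymmetric_of_span {E ι : Type*} [NormedAddCommGroup E] [InnerProductSpace ℝ E]
    (g h : ι → E) (hg : Submodule.span ℝ (Set.range g) = ⊤)
    (hgh : ∀ i j, ⟪h i, g j⟫_ℝ = ⟪g i, h j⟫_ℝ) :
    ∃ X : E →ₗ[ℝ] E, X.IsSymmetric ∧ ∀ i, X (g i) = h i := by
  set P := Finsupp.linearCombination ℝ g with hP
  set Q := Finsupp.linearCombination ℝ h with hQ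
  obtain ⟨σ, hσ⟩ := P.exists_rightInverse_of_surjective (by rw [Finsupp.range_linearCombination, hg])
  have hsym : ∀ c d, ⟪Q c, P d⟫_ℝ = ⟪P c, Q d⟫_ℝ := by
    intro c d
    simp only [hP, hQ, Finsupp.linearCombination_apply, Finsupp.sum, sum_inner, inner_sum,
      real_inner_smul_left, real_inner_smul_right, hgh]
  -- Well-definedness: by symmetry `Q c` is orthogonal to every `P d`, and these exhaust `E`.
  have hker : ∀ c, P c = 0 → Q c = 0 := by
    intro c hc
    refine ext_inner_right ℝ fun w => ?_
    have hw : P (σ w) = w := congrArg (fun f => f w) hσ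
    rw [← hw, hsym, hc, inner_zero_left, inner_zero_left]
  have hX : ∀ c, Q (σ (P c)) = Q c := by
    intro c
    have h1 : P (σ (P c)) = P c := congrArg (fun f => f (P c)) hσ
    have h2 := hker (σ (P c) - c) (by rw [map_sub, h1, sub_self])
    rwa [map_sub, sub_eq_zero] at h2
  refine ⟨Q ∘ₗ σ, fun v w => ?_, fun i => ?_⟩
  · have hv : P (σ v) = v := congrArg (fun f => f v) hσ
    have hw : P (σ w) = w := congrArg (fun f => f w) hσ
    simpa [hv, hw] using hsym (σ v) (σ w)
  · simpa [hP, hQ] using hX (Finsupp.single i 1)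

/-- A commuting family of symmetric operators has an orthonormal basis of joint eigenvectors. -/
theorem exists_orthonormalBasis_joint_eigenvectors {E ι : Type*} [NormedAddCommGroup E]
    [InnerProductSpace ℝ E] [FiniteDimensional ℝ E] (X : ι → E →ₗ[ℝ] E)
    (hX : ∀ l, (X l).IsSymmetric) (hc : ∀ l l', Commute (X l) (X l')) :
    ∃ (b : OrthonormalBasis (Fin (Module.finrank ℝ E)) ℝ E)
      (y : Fin (Module.finrank ℝ E) → ι → ℝ), ∀ i l, X l (b i) = y i l • b i := by
  classical
  have hI := LinearMap.IsSymmetric.directSum_isInternal_of_pairwise_commute hX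
    (fun l l' _ => hc l l')
  have hO := LinearMap.IsSymmetric.orthogonalFamily_iInf_eigenspaces hX
  let b := hI.collectedBasis fun y => (stdOrthonormalBasis ℝ
    (⨅ l, Module.End.eigenspace (X l) (y l) : Submodule ℝ E)).toBasis
  have hb : Orthonormal ℝ b := DirectSum.IsInternal.collectedBasis_orthonormal hO hI fun y => by simp
  -- The candidate eigenvalues range over all of `ι → ℝ`; the index type is finite because it labels
  -- a basis of `E`.
  have : Finite (Σ y : ι → ℝ, Fin (Module.finrank ℝ
      (⨅ l, Module.End.eigenspace (X l) (y l) : Submodule ℝ E))) := Module.Finite.finite_basis b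
  have := Fintype.ofFinite (Σ y : ι → ℝ, Fin (Module.finrank ℝ
      (⨅ l, Module.End.eigenspace (X l) (y l) : Submodule ℝ E)))
  let e := Fintype.equivFinOfCardEq (Module.finrank_eq_card_basis b).symm
  refine ⟨(b.toOrthonormalBasis hb).reindex e, fun i => (e.symm i).1, fun i l => ?_⟩
  have hm := hI.collectedBasis_mem (fun y => (stdOrthonormalBasis ℝ
    (⨅ l, Module.End.eigenspace (X l) (y l) : Submodule ℝ E)).toBasis) (e.symm i)
  have h2 := Module.End.mem_eigenspace_iff.mp ((Submodule.mem_iInf _).mp hm l)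
  simpa [b] using h2

/-! ### Multi-indices -/

theorem prod_pow_add {n : ℕ} (x : Fin n → ℝ) (α β : Fin n →₀ ℕ) :
    ∏ l, x l ^ (α + β) l = (∏ l, x l ^ α l) * ∏ l, x l ^ β l := by
  simp [pow_add, Finset.prod_mul_distrib]

theorem exists_eq_add_single {n d : ℕ} {α : Fin n →₀ ℕ} (h : α.degree = d + 1) :
    ∃ (l : Fin n) (β : Fin n →₀ ℕ), β.degree = d ∧ α = β + Finsupp.single l 1 := by
  have h0 : α ≠ 0 := by
    rintro rfl
    simp at h
  obtain ⟨l, hl⟩ := Finsupp.ne_iff.mp h0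
  have hle : Finsupp.single l 1 ≤ α := by
    rw [Finsupp.single_le_iff]
    exact Nat.one_le_iff_ne_zero.mpr hl
  have he : α - Finsupp.single l 1 + Finsupp.single l 1 = α := tsub_add_cancel_of_le hle
  refine ⟨l, α - Finsupp.single l 1, ?_, he.symm⟩
  have := congrArg Finsupp.degree he
  rw [map_add, Finsupp.degree_single, h] at this
  omega

/-- With `s = t`, this makes each `S_α` with `|α| ≤ 2t` a block of the moment matrix of order `t`.
-/
theorem exists_add_degree_le {n : ℕ} (s : ℕ) : ∀ (t : ℕ) (α : Fin n →₀ ℕ), α.degree ≤ s + t →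
    ∃ β γ : Fin n →₀ ℕ, β.degree ≤ s ∧ γ.degree ≤ t ∧ α = β + γ := by
  intro t
  induction t with
  | zero => exact fun α h => ⟨α, 0, h, by simp, by simp⟩
  | succ t ih =>
    intro α h
    rcases Nat.lt_or_ge α.degree (s + t + 1) with h1 | h1
    · obtain ⟨β, γ, hβ, hγ, he⟩ := ih α (by omega)
      exact ⟨β, γ, hβ, by omega, he⟩
    · obtain ⟨l, α', hα', rfl⟩ := exists_eq_add_single (d := s + t) (α := α) (by omega)
      obtain ⟨β, γ, hβ, hγ, rfl⟩ := ih α' hα'.le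
      exact ⟨β, γ + Finsupp.single l 1, hβ,
        by rw [map_add, Finsupp.degree_single]; omega, by rw [add_assoc]⟩

/-! ### Flat extensions of matrix-valued sequences -/

theorem eq_of_forall_inner_eq_of_span {E ι : Type*} [NormedAddCommGroup E]
    [InnerProductSpace ℝ E] {g : ι → E} (hg : Submodule.span ℝ (Set.range g) = ⊤) {u v : E}
    (h : ∀ i, ⟪u, g i⟫_ℝ = ⟪v, g i⟫_ℝ) : u = v := by
  have h' : innerₛₗ ℝ u = innerₛₗ ℝ v := LinearMap.ext_on_range hg h
  exact ext_inner_right ℝ fun w => congrArg (fun f => f w) h'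

/-- Gram vectors of a moment matrix of order `s + 1` whose part of order `s` already spans are
diagonalized simultaneously. -/
theorem exists_orthonormalBasis_of_gram {n m s : ℕ} {E : Type*} [NormedAddCommGroup E]
    [InnerProductSpace ℝ E] [FiniteDimensional ℝ E] (S : MatSeq n m)
    (g : (Fin n →₀ ℕ) → Fin m → E)
    (hg : ∀ α β, α.degree ≤ s + 1 → β.degree ≤ s + 1 → ∀ a b, ⟪g α a, g β b⟫_ℝ = S (α + β) a b)
    (hspan : Submodule.span ℝ (Set.range fun p : MultiIdx n s × Fin m => g p.1.1 p.2) = ⊤) :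
    ∃ (b : OrthonormalBasis (Fin (Module.finrank ℝ E)) ℝ E)
      (y : Fin (Module.finrank ℝ E) → Fin n → ℝ), ∀ i α, α.degree ≤ s + 1 → ∀ a,
        ⟪g α a, b i⟫_ℝ = (∏ l, y i l ^ α l) * ⟪g 0 a, b i⟫_ℝ := by
  have hdeg : ∀ (p : MultiIdx n s) l, (p.1 + Finsupp.single l 1).degree ≤ s + 1 := by
    intro p l
    rw [map_add, Finsupp.degree_single]
    exact Nat.add_le_add_right p.2 1
  have hex : ∀ l : Fin n, ∃ X : E →ₗ[ℝ] E, X.IsSymmetric ∧ ∀ p : MultiIdx n s × Fin m,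
      X (g p.1.1 p.2) = g (p.1.1 + Finsupp.single l 1) p.2 := fun l =>
    exists_isSymmetric_of_span _ (fun p : MultiIdx n s × Fin m => g (p.1.1 + Finsupp.single l 1) p.2)
      hspan fun p p' => by
      rw [hg _ _ (hdeg _ _) (p'.1.2.trans s.le_succ), hg _ _ (p.1.2.trans s.le_succ) (hdeg _ _)]
      congr 1
      abel_nf
  choose X hX hXg using hex
  have hcomm : ∀ l l', Commute (X l) (X l') := by
    -- After one shift the degree may be `s + 1`, where a second shift is unavailable. Symmetry
    -- moves the outer operator to the other argument instead, and both sides become the same entry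
    -- of `S`.
    refine fun l l' => LinearMap.ext_on_range hspan fun p => ?_
    refine eq_of_forall_inner_eq_of_span hspan fun p' => ?_
    simp only [Module.End.mul_apply]
    rw [hX l (X l' _), hX l' (X l _), hXg, hXg, hXg, hXg, hg _ _ (hdeg _ _) (hdeg _ _),
      hg _ _ (hdeg _ _) (hdeg _ _)]
    congr 1
    abel_nf
  obtain ⟨b, y, hb⟩ := exists_orthonormalBasis_joint_eigenvectors X hX hcomm
  refine ⟨b, y, fun i α hα a => ?_⟩
  obtain ⟨d, hd⟩ : ∃ d, α.degree = d := ⟨_, rfl⟩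
  induction d generalizing α with
  | zero =>
    obtain rfl : α = 0 := (Finsupp.degree_eq_zero_iff α).mp hd
    simp
  | succ d ih =>
    obtain ⟨l, β, hβ, rfl⟩ := exists_eq_add_single hd
    have h1 := hXg l (⟨β, by omega⟩, a)
    rw [← h1, hX l, hb, real_inner_smul_right]
    simp only
    rw [ih β (by omega) hβ, prod_pow_add, ← mul_assoc]
    congr 1
    rw [mul_comm]
    congr 1
    rw [Finset.prod_eq_single l] <;> simp +contextual [eq_comm]

/-- Gram vectors spanned by their part of order `t - δ` give finitely many rank-one atoms, which
are separated by vector polynomials of degree at most `t - δ`. -/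
theorem exists_rankOne_atoms_of_gram {n m t δ : ℕ} {E : Type*} [NormedAddCommGroup E]
    [InnerProductSpace ℝ E] [FiniteDimensional ℝ E] (hδ : 1 ≤ δ) (hδt : δ ≤ t) (S : MatSeq n m)
    (g : (Fin n →₀ ℕ) → Fin m → E)
    (hgram : ∀ α β, α.degree ≤ t → β.degree ≤ t → ∀ a b, ⟪g α a, g β b⟫_ℝ = S (α + β) a b)
    (htop : Submodule.span ℝ
      (Set.range fun p : MultiIdx n (t - δ) × Fin m => g p.1.1 p.2) = ⊤) :
    ∃ (N : ℕ) (y : Fin N → Fin n → ℝ) (w : Fin N → Fin m → ℝ)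
      (c : Fin N → MultiIdx n (t - δ) × Fin m → ℝ),
      (∀ α : Fin n →₀ ℕ, α.degree ≤ 2 * t → ∀ a b,
        S α a b = ∑ i, (∏ l, y i l ^ α l) * (w i a * w i b)) ∧
      ∀ i j, ∑ p, c i p * ((∏ l, y j l ^ p.1.1 l) * w j p.2) = if i = j then 1 else 0 := by
  obtain ⟨s, rfl⟩ : ∃ s, t = s + 1 := ⟨t - 1, by omega⟩
  -- Since `δ ≥ 1`, spanning in degree `t - δ` implies spanning in degree `s = t - 1`, which is all
  -- that the multiplication operators need.
  have htop' : Submodule.span ℝ (Set.range fun p : MultiIdx n s × Fin m => g p.1.1 p.2) = ⊤ := by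
    refine top_le_iff.mp (htop.symm.le.trans (Submodule.span_mono ?_))
    rintro _ ⟨p, rfl⟩
    exact ⟨(⟨p.1.1, p.1.2.trans (by omega)⟩, p.2), rfl⟩
  obtain ⟨b, y, hby⟩ := exists_orthonormalBasis_of_gram S g hgram htop'
  have hc : ∀ i, ∃ c : MultiIdx n (s + 1 - δ) × Fin m → ℝ, ∑ p, c p • g p.1.1 p.2 = b i := by
    intro i
    have : b i ∈ Submodule.span ℝ (Set.range fun p : MultiIdx n (s + 1 - δ) × Fin m =>
      g p.1.1 p.2) := htop ▸ Submodule.mem_top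
    exact (Submodule.mem_span_range_iff_exists_fun ℝ).mp this
  choose c hc using hc
  -- The moment formula is Parseval in the basis `b`; the separation identity is its orthonormality,
  -- with `b i` expanded in low-degree Gram vectors.
  refine ⟨_, y, fun i a => ⟪g 0 a, b i⟫_ℝ, c, fun α hα a a' => ?_, fun i j => ?_⟩
  · obtain ⟨β, γ, hβ, hγ, rfl⟩ := exists_add_degree_le (s + 1) (s + 1) α (by omega)
    rw [← hgram β γ hβ hγ, ← b.sum_inner_mul_inner]
    refine Finset.sum_congr rfl fun i _ => ?_
    rw [real_inner_comm (g γ a') (b i), hby i β hβ, hby i γ hγ, prod_pow_add]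
    ring
  · rw [← orthonormal_iff_ite.mp b.orthonormal i j, ← hc i, sum_inner]
    refine Finset.sum_congr rfl fun p _ => ?_
    rw [real_inner_smul_left, hby j p.1.1 (p.1.2.trans (Nat.sub_le _ _))]

/-- A positive semidefinite moment matrix with a flat drop of `δ ≥ 1` comes from finitely many
rank-one atoms, which are separated by vector polynomials of degree at most `t - δ`. -/
theorem exists_rankOne_atoms_of_flat {n m : ℕ} {t δ : ℕ} (hδ : 1 ≤ δ) (hδt : δ ≤ t)
    (S : MatSeq n m) (hM : (momentMat t S).PosSemidef)
    (hrank : (momentMat t S).rank = (momentMat (t - δ) S).rank) :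
    ∃ (N : ℕ) (y : Fin N → Fin n → ℝ) (w : Fin N → Fin m → ℝ)
      (c : Fin N → MultiIdx n (t - δ) × Fin m → ℝ),
      (∀ α : Fin n →₀ ℕ, α.degree ≤ 2 * t → ∀ a b,
        S α a b = ∑ i, (∏ l, y i l ^ α l) * (w i a * w i b)) ∧
      ∀ i j, ∑ p, c i p * ((∏ l, y j l ^ p.1.1 l) * w j p.2) = if i = j then 1 else 0 := by
  classical
  obtain ⟨B, hB⟩ := exists_gram_of_posSemidef hM
  let e : MultiIdx n (t - δ) × Fin m → MultiIdx n t × Fin m :=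
    fun p => (⟨p.1.1, p.1.2.trans (Nat.sub_le t δ)⟩, p.2)
  let col : MultiIdx n t × Fin m → EuclideanSpace ℝ (MultiIdx n t × Fin m) :=
    fun p => WithLp.toLp 2 (B.col p)
  have hcol : ∀ p p', ⟪col p, col p'⟫_ℝ = momentMat t S p p' := by
    intro p p'
    rw [hB]
    simp [col, PiLp.inner_apply, Matrix.mul_apply, mul_comm]
  have hsub : momentMat (t - δ) S =
      (B.submatrix id e).conjTranspose * B.submatrix id e :=
    congrArg (fun A => A.submatrix e e) hB
  have hspan_eq : ∀ {κ : Type} (f : κ → MultiIdx n t × Fin m),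
      Submodule.span ℝ (Set.range fun k => col (f k)) =
      (Submodule.span ℝ (Set.range (B.submatrix id f).col)).map
        (WithLp.linearEquiv 2 ℝ (MultiIdx n t × Fin m → ℝ)).symm.toLinearMap := by
    intro κ f
    rw [Submodule.map_span, ← Set.range_comp]
    rfl
  have hle : Submodule.span ℝ (Set.range fun p => col (e p)) ≤
      Submodule.span ℝ (Set.range col) :=
    Submodule.span_mono (Set.range_comp_subset_range e col)
  -- A Gram matrix has rank equal to the dimension of the span of its vectors, so equal ranks force
  -- the nested spans to coincide.
  have hflat : Submodule.span ℝ (Set.range fun p => col (e p)) =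
      Submodule.span ℝ (Set.range col) := by
    apply Submodule.eq_of_le_of_finrank_eq hle
    have h1 := hspan_eq e
    have h2 := hspan_eq id
    simp only [id] at h2
    rw [h1, h2, LinearEquiv.finrank_map_eq, LinearEquiv.finrank_map_eq,
      ← Matrix.rank_eq_finrank_span_cols, ← Matrix.rank_eq_finrank_span_cols,
      Matrix.submatrix_id_id, ← Matrix.rank_conjTranspose_mul_self (B.submatrix id e), ← hsub,
      ← hrank, hB, Matrix.rank_conjTranspose_mul_self]
  obtain ⟨H, hH⟩ : ∃ H, H = Submodule.span ℝ (Set.range col) := ⟨_, rfl⟩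
  -- Restricting to the span `H` of the columns turns flatness into spanning the whole space. The
  -- value `0` above degree `t` is never inspected.
  let g : (Fin n →₀ ℕ) → Fin m → H := fun α a =>
    if h : α.degree ≤ t then ⟨col (⟨α, h⟩, a), hH ▸ Submodule.subset_span ⟨_, rfl⟩⟩ else 0
  have hgram : ∀ α β, α.degree ≤ t → β.degree ≤ t → ∀ a b,
      ⟪g α a, g β b⟫_ℝ = S (α + β) a b := by
    intro α β hα hβ a b
    simp only [g, hα, hβ, dif_pos, Submodule.coe_inner, hcol]
    rfl
  have htop : Submodule.span ℝ (Set.range fun p : MultiIdx n (t - δ) × Fin m =>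
      g p.1.1 p.2) = ⊤ := by
    apply Submodule.map_injective_of_injective H.injective_subtype
    rw [Submodule.map_span, Submodule.map_top, Submodule.range_subtype, ← Set.range_comp]
    refine Eq.trans ?_ (hflat.trans hH.symm)
    congr 2
    ext1 p
    have : p.1.1.degree ≤ t := p.1.2.trans (Nat.sub_le t δ)
    simp [g, this, e]
  exact exists_rankOne_atoms_of_gram hδ hδt S g hgram htop

/-! ### Polynomial matrices and the Riesz functional -/

theorem isHermitian_evalAt {n m : ℕ} {F : PolyMat n m m} (hF : F.IsSymm) (x : Fin n → ℝ) :
    (evalAt F x).IsHermitian := by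
  rw [Matrix.IsHermitian, Matrix.conjTranspose_eq_transpose_of_trivial]
  exact hF.map _

theorem degree_le_deg_of_mem_supp {n a b : ℕ} {T : PolyMat n a b} {γ : Fin n →₀ ℕ}
    (hγ : γ ∈ supp T) : γ.degree ≤ deg T := by
  simp only [supp, Finset.mem_biUnion, Finset.mem_univ, true_and] at hγ
  obtain ⟨i, j, h⟩ := hγ
  calc γ.degree ≤ (T i j).totalDegree := MvPolynomial.le_totalDegree h
    _ ≤ Finset.univ.sup fun j => (T i j).totalDegree :=
      Finset.le_sup (f := fun j => (T i j).totalDegree) (Finset.mem_univ j)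
    _ ≤ deg T := Finset.le_sup (f := fun i => Finset.univ.sup fun j => (T i j).totalDegree)
      (Finset.mem_univ i)

theorem deg_one {n m : ℕ} : deg (1 : PolyMat n m m) = 0 := by
  rw [deg, ← Nat.le_zero]
  refine Finset.sup_le fun i _ => Finset.sup_le fun j _ => ?_
  rw [Matrix.one_apply]
  split_ifs <;> simp

theorem evalAt_apply_eq_sum {n a b : ℕ} (T : PolyMat n a b) (x : Fin n → ℝ) (i : Fin a)
    (j : Fin b) :
    evalAt T x i j = ∑ γ ∈ supp T, (∏ l, x l ^ γ l) * coeffMat T γ i j := by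
  simp only [evalAt, coeffMat, Matrix.map_apply, MvPolynomial.eval_eq']
  refine Finset.sum_subset_zero_on_sdiff ?_ ?_ fun γ _ => mul_comm _ _
  · intro γ h
    simp only [supp, Finset.mem_biUnion, Finset.mem_univ, true_and]
    exact ⟨i, j, h⟩
  · intro γ h
    rw [MvPolynomial.notMem_support_iff.mp (Finset.mem_sdiff.mp h).2, mul_zero]

theorem riesz_eq_sum_trace {n m N : ℕ} {ι : Type*} [Fintype ι] {S : MatSeq n m} (F : PolyMat n m m)
    (x : ι → Fin n → ℝ) (W : ι → Matrix (Fin m) (Fin m) ℝ)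
    (hS : ∀ α : Fin n →₀ ℕ, α.degree ≤ N → ∀ a b, S α a b = ∑ i, (∏ l, x i l ^ α l) * W i a b)
    (hF : deg F ≤ N) : riesz S F = ∑ i, (evalAt F (x i) * W i).trace := by
  have h1 : ∀ α ∈ supp F, (coeffMat F α * S α).trace =
      ∑ i, ∑ a, ∑ b, (∏ l, x i l ^ α l) * coeffMat F α a b * W i b a := by
    intro α hα
    simp only [Matrix.trace, Matrix.diag, Matrix.mul_apply,
      hS α ((degree_le_deg_of_mem_supp hα).trans hF), Finset.mul_sum]
    rw [Finset.sum_comm (s := Finset.univ (α := ι))]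
    refine Finset.sum_congr rfl fun a _ => ?_
    rw [Finset.sum_comm]
    refine Finset.sum_congr rfl fun i _ => Finset.sum_congr rfl fun b _ => ?_
    ring
  rw [riesz, Finset.sum_congr rfl h1, Finset.sum_comm]
  refine Finset.sum_congr rfl fun i _ => ?_
  simp only [Matrix.trace, Matrix.diag, Matrix.mul_apply, evalAt_apply_eq_sum, Finset.sum_mul]
  rw [Finset.sum_comm]
  refine Finset.sum_congr rfl fun a _ => ?_
  rw [Finset.sum_comm]

theorem evalAt_one {n m : ℕ} (x : Fin n → ℝ) : evalAt (1 : PolyMat n m m) x = 1 :=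
  Matrix.map_one _ (map_zero _) (map_one _)

theorem riesz_one_eq_sum_trace {n m N : ℕ} {ι : Type*} [Fintype ι] {S : MatSeq n m}
    (x : ι → Fin n → ℝ) (W : ι → Matrix (Fin m) (Fin m) ℝ)
    (hS : ∀ α : Fin n →₀ ℕ, α.degree ≤ N → ∀ a b, S α a b = ∑ i, (∏ l, x i l ^ α l) * W i a b) :
    riesz S (1 : PolyMat n m m) = ∑ i, (W i).trace := by
  rw [riesz_eq_sum_trace 1 x W hS (deg_one.trans_le N.zero_le)]
  simp [evalAt_one]

/-! ### Localizing matrices of atomic sequences -/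

theorem localizingMat_apply_of_atoms {n m q d N : ℕ} {ι : Type*} [Fintype ι] {S : MatSeq n m}
    (G : PolyMat n q q) (y : ι → Fin n → ℝ) (w : ι → Fin m → ℝ)
    (hS : ∀ α : Fin n →₀ ℕ, α.degree ≤ N → ∀ a b,
      S α a b = ∑ i, (∏ l, y i l ^ α l) * (w i a * w i b))
    (hN : 2 * d + deg G ≤ N) (P P' : MultiIdx n d × (Fin m × Fin q)) :
    localizingMat d G S P P' =
      ∑ i, ((∏ l, y i l ^ P.1.1 l) * w i P.2.1) * ((∏ l, y i l ^ P'.1.1 l) * w i P'.2.1) *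
        evalAt G (y i) P.2.2 P'.2.2 := by
  simp only [localizingMat, Matrix.of_apply, Matrix.sum_apply, Matrix.kronecker,
    Matrix.kroneckerMap_apply, evalAt_apply_eq_sum, Finset.mul_sum]
  rw [Finset.sum_comm]
  refine Finset.sum_congr rfl fun γ hγ => ?_
  rw [hS _ (by
    have := degree_le_deg_of_mem_supp hγ
    have h1 := P.1.2
    have h2 := P'.1.2
    simp only [map_add]
    omega), Finset.sum_mul]
  refine Finset.sum_congr rfl fun i _ => ?_
  rw [prod_pow_add, prod_pow_add]
  ring

/-- On a product vector, one atom's contribution to the localizing form splits into the square of a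
scalar and a quadratic form in `G` at the atom. -/
theorem sum_prod_sum_prod_mul {A B : Type*} [Fintype A] [Fintype B] (f : A → ℝ) (u : B → ℝ)
    (H : B → B → ℝ) :
    ∑ P : A × B, ∑ P' : A × B, (f P.1 * u P.2) * (H P.2 P'.2 * (f P'.1 * u P'.2)) =
      (∑ a, f a) * (∑ a, f a) * ∑ r, ∑ r', u r * (H r r' * u r') := by
  have h : ∀ r, ∑ P' : A × B, H r P'.2 * (f P'.1 * u P'.2) = (∑ a, f a) * ∑ r', H r r' * u r' := by
    intro r
    rw [Finset.sum_mul_sum, Fintype.sum_prod_type]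
    exact Finset.sum_congr rfl fun a _ => Finset.sum_congr rfl fun b _ => by ring
  simp only [← Finset.mul_sum, h]
  rw [mul_assoc, Finset.sum_mul, Fintype.sum_prod_type]
  refine Finset.sum_congr rfl fun a _ => ?_
  rw [Finset.mul_sum, Finset.mul_sum]
  exact Finset.sum_congr rfl fun b _ => by ring

/-- Points of an atomic sequence that are separated in degree `d` satisfy the matrix inequality
imposed by the localizing matrix of order `d`. -/
theorem posSemidef_evalAt_of_localizingMat {n m q d N r : ℕ} {S : MatSeq n m} {G : PolyMat n q q}
    (hG : G.IsSymm) (y : Fin r → Fin n → ℝ) (w : Fin r → Fin m → ℝ)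
    (hS : ∀ α : Fin n →₀ ℕ, α.degree ≤ N → ∀ a b,
      S α a b = ∑ i, (∏ l, y i l ^ α l) * (w i a * w i b))
    (hN : 2 * d + deg G ≤ N) (hL : (localizingMat d G S).PosSemidef) (i : Fin r)
    (c : MultiIdx n d × Fin m → ℝ)
    (hc : ∀ j, ∑ p, c p * ((∏ l, y j l ^ p.1.1 l) * w j p.2) = if i = j then 1 else 0) :
    (evalAt G (y i)).PosSemidef := by
  refine .of_dotProduct_mulVec_nonneg (isHermitian_evalAt hG _) fun u => ?_
  -- The test vector is `c ⊗ u`: `c` annihilates every atom except `i`, where it gives `1`.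
  have h := hL.dotProduct_mulVec_nonneg fun P => c (P.1, P.2.1) * u P.2.2
  refine h.trans_eq ?_
  have key : ∀ j, ∑ P : MultiIdx n d × (Fin m × Fin q), ∑ P' : MultiIdx n d × (Fin m × Fin q),
      (c (P.1, P.2.1) * u P.2.2) *
        ((((∏ l, y j l ^ P.1.1 l) * w j P.2.1) * ((∏ l, y j l ^ P'.1.1 l) * w j P'.2.1) *
        evalAt G (y j) P.2.2 P'.2.2) * (c (P'.1, P'.2.1) * u P'.2.2)) =
      (if i = j then 1 else 0) * (u ⬝ᵥ (evalAt G (y j)).mulVec u) := by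
    intro j
    -- The indicator equals its square, which supplies one factor for each side of the quadratic
    -- form.
    have hif : (if i = j then (1 : ℝ) else 0) =
        (if i = j then 1 else 0) * (if i = j then 1 else 0) := by split_ifs <;> simp
    rw [hif, ← hc j]
    simp only [dotProduct, Matrix.mulVec, Finset.mul_sum (s := Finset.univ (α := Fin q))]
    refine Eq.trans ?_ ((sum_prod_sum_prod_mul (fun p : MultiIdx n d × Fin m =>
      c p * ((∏ l, y j l ^ p.1.1 l) * w j p.2)) u (evalAt G (y j))).trans ?_)
    · refine Fintype.sum_equiv (Equiv.prodAssoc _ _ _).symm _ _ fun P => ?_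
      refine Fintype.sum_equiv (Equiv.prodAssoc _ _ _).symm _ _ fun P' => ?_
      simp only [Equiv.prodAssoc_symm_apply]
      ring
    · simp only [Finset.mul_sum]
  simp only [dotProduct, Matrix.mulVec, star_trivial,
    localizingMat_apply_of_atoms G y w hS hN, Finset.mul_sum, Finset.sum_mul]
  rw [Finset.sum_congr rfl fun P _ => Finset.sum_comm, Finset.sum_comm]
  simp only [key]
  simp [dotProduct, Matrix.mulVec, Finset.mul_sum]

/-! ### Point evaluations are feasible -/

/-- These are the moments of `v vᵀ δ_y`. With `z = (y^α v_a)`, the moment matrix is `z zᵀ` and the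
localizing matrix is `z zᵀ ⊗ G(y)`, up to reindexing. -/
theorem pointSeq_mem_relaxFeasible {n m q : ℕ} (k : ℕ) {G : PolyMat n q q} {y : Fin n → ℝ}
    (hy : y ∈ feasibleSet G) {v : Fin m → ℝ} (hv : v ⬝ᵥ v = 1) :
    (fun α => (∏ l, y l ^ α l) • Matrix.vecMulVec v v : MatSeq n m) ∈ relaxFeasible k G := by
  have hS : ∀ α : Fin n →₀ ℕ, ∀ a b,
      ((fun α => (∏ l, y l ^ α l) • Matrix.vecMulVec v v : MatSeq n m)) α a b =
        ∑ _i : Unit, (∏ l, y l ^ α l) * (v a * v b) := by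
    intro α a b
    simp [Matrix.vecMulVec_apply]
  refine ⟨⟨fun α _ => ?_, ?_, ?_⟩, ?_⟩
  · ext a b
    simp [Matrix.vecMulVec_apply, mul_comm]
  · convert! Matrix.posSemidef_vecMulVec_self_star
      (fun p : MultiIdx n k × Fin m => (∏ l, y l ^ p.1.1 l) * v p.2) using 1
    ext p p'
    simp only [momentMat, Matrix.of_apply, Matrix.vecMulVec_apply, star_trivial,
      prod_pow_add, Matrix.smul_apply, smul_eq_mul]
    ring
  · convert! ((Matrix.posSemidef_vecMulVec_self_star
      (fun p : MultiIdx n (k - halfDeg G) × Fin m => (∏ l, y l ^ p.1.1 l) * v p.2)).kronecker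
      (show (evalAt G y).PosSemidef from hy)).submatrix (Equiv.prodAssoc _ _ _).symm using 1
    ext P P'
    rw [localizingMat_apply_of_atoms G (fun _ : Unit => y) (fun _ => v)
      (fun α _ => hS α) le_rfl]
    simp [Matrix.vecMulVec_apply]
  · rw [riesz_one_eq_sum_trace (N := 0) (fun _ : Unit => y) (fun _ => Matrix.vecMulVec v v)
      (fun α _ => by simp)]
    simpa [Matrix.trace_vecMulVec] using hv

theorem riesz_pointSeq {n m : ℕ} (F : PolyMat n m m) (y : Fin n → ℝ) (v : Fin m → ℝ) :
    riesz (fun α => (∏ l, y l ^ α l) • Matrix.vecMulVec v v : MatSeq n m) F =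
      v ⬝ᵥ (evalAt F y).mulVec v := by
  rw [riesz_eq_sum_trace (N := deg F) F (fun _ : Unit => y) (fun _ => Matrix.vecMulVec v v)
    (fun α _ a b => by simp) le_rfl]
  simp [Matrix.mul_vecMulVec, Matrix.trace_vecMulVec, dotProduct_comm]

/-! ### Atomic matrix measures -/

section Measure

variable {n m r : ℕ} {X : Set (Fin n → ℝ)} (x : Fin r → X) (W : Fin r → Matrix (Fin m) (Fin m) ℝ)

/-- The variation is a finite multiple of a point mass, against which every real function is
integrable. -/
theorem integrable_dirac_vectorMeasure (f : X → ℝ) (z : X) (c : ℝ) :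
    (MeasureTheory.VectorMeasure.dirac z c).Integrable f := by
  rw [MeasureTheory.VectorMeasure.Integrable, MeasureTheory.VectorMeasure.variation_dirac]
  exact (MeasureTheory.integrable_dirac enorm_lt_top).smul_measure enorm_ne_top

theorem atomicMeasure_integrable (f : X → ℝ) (a b : Fin m) :
    (atomicMeasure x W a b).Integrable f := by
  rw [atomicMeasure, Matrix.of_apply]
  exact MeasureTheory.VectorMeasure.Integrable.finsetSum_vectorMeasure
    fun i _ => integrable_dirac_vectorMeasure f (x i) (W i a b)

theorem atomicMeasure_integral (f : X → ℝ) (a b : Fin m) :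
    (atomicMeasure x W a b).integral f (ContinuousLinearMap.lsmul ℝ ℝ) =
      ∑ i, f (x i) * W i a b := by
  rw [atomicMeasure, Matrix.of_apply,
    MeasureTheory.VectorMeasure.integral_finsetSum_vectorMeasure
      fun i _ => integrable_dirac_vectorMeasure f (x i) (W i a b)]
  simp

theorem atomicMeasure_isPSD (hW : ∀ i, (W i).PosSemidef) : (atomicMeasure x W).IsPSD := by
  classical
  refine ⟨?_, fun A hA => ?_⟩
  · ext1 a b
    simp only [Matrix.transpose_apply, atomicMeasure, Matrix.of_apply]
    refine Finset.sum_congr rfl fun i _ => ?_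
    rw [← (hW i).isHermitian.apply, star_trivial]
  · have h : (Matrix.of fun a b => atomicMeasure x W a b A) =
        ∑ i, if x i ∈ A then W i else 0 := by
      ext a b
      simp only [atomicMeasure, Matrix.of_apply, Matrix.sum_apply, FunLike.coe_sum,
        Finset.sum_apply]
      refine Finset.sum_congr rfl fun i _ => ?_
      split_ifs with hi
      · exact MeasureTheory.VectorMeasure.dirac_apply_of_mem hA hi
      · exact MeasureTheory.VectorMeasure.dirac_apply_of_notMem hi
    rw [h]
    refine Matrix.posSemidef_sum _ fun i _ => ?_
    split_ifs
    exacts [hW i, .zero]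

theorem atomicMeasure_represents_iff (hW : ∀ i, (W i).PosSemidef) (N : ℕ) (S : MatSeq n m) :
    (atomicMeasure x W).Represents N S ↔ ∀ α : Fin n →₀ ℕ, α.degree ≤ N → ∀ a b,
      S α a b = ∑ i, (∏ l, (x i).1 l ^ α l) * W i a b := by
  simp only [MatMeasure.Represents, atomicMeasure_isPSD x W hW, true_and,
    atomicMeasure_integrable, atomicMeasure_integral]

end Measure

/-- Rank-one atoms in `X`, possibly with repeated points, can be collected at distinct points. -/
theorem exists_distinct_atoms {n m N : ℕ} {X : Set (Fin n → ℝ)} (y : Fin N → Fin n → ℝ)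
    (hy : ∀ j, y j ∈ X) (w : Fin N → Fin m → ℝ) (hw : ∀ j, w j ≠ 0) :
    ∃ (r : ℕ) (x : Fin r → X) (W : Fin r → Matrix (Fin m) (Fin m) ℝ),
      Function.Injective x ∧ (∀ i, (W i).PosSemidef ∧ W i ≠ 0) ∧
      ∀ (f : (Fin n → ℝ) → ℝ) a b, ∑ j, f (y j) * (w j a * w j b) = ∑ i, f (x i) * W i a b := by
  classical
  let e := Fintype.equivFin (Set.range y)
  let x : Fin (Fintype.card (Set.range y)) → X := fun i =>
    ⟨(e.symm i).1, by obtain ⟨j, hj⟩ := (e.symm i).2; exact hj ▸ hy j⟩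
  let W : Fin (Fintype.card (Set.range y)) → Matrix (Fin m) (Fin m) ℝ := fun i =>
    ∑ j, if y j = (x i).1 then Matrix.vecMulVec (w j) (w j) else 0
  have hx : Function.Injective x := by
    intro i i' h
    have h' : (x i).1 = (x i').1 := congrArg Subtype.val h
    exact e.symm.injective (Subtype.ext h')
  have hterm : ∀ i j, (if y j = (x i).1 then Matrix.vecMulVec (w j) (w j) else 0).PosSemidef := by
    intro i j
    split_ifs
    exacts [Matrix.posSemidef_vecMulVec_self_star (w j), .zero]
  refine ⟨_, x, W, hx, fun i => ⟨Matrix.posSemidef_sum _ fun j _ => hterm i j, fun h => ?_⟩, ?_⟩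
  · obtain ⟨j, hj⟩ := (e.symm i).2
    have h1 : (W i).trace = 0 := by rw [h, Matrix.trace_zero]
    -- Nonnegative traces cannot cancel, so `W i = 0` would force `w j = 0` for an atom `j` at this
    -- point.
    rw [Matrix.trace_sum, Finset.sum_eq_zero_iff_of_nonneg fun j _ => (hterm i j).trace_nonneg]
      at h1
    have h2 := h1 j (Finset.mem_univ j)
    rw [if_pos hj, Matrix.trace_vecMulVec, dotProduct_self_eq_zero] at h2
    exact hw j h2
  · intro f a b
    simp only [W, Matrix.sum_apply, Finset.mul_sum]
    rw [Finset.sum_comm]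
    refine Finset.sum_congr rfl fun j _ => ?_
    have hj : (x (e ⟨y j, j, rfl⟩)).1 = y j := by simp [x]
    rw [Finset.sum_eq_single (e ⟨y j, j, rfl⟩)]
    · rw [if_pos hj.symm, hj, Matrix.vecMulVec_apply]
    · intro i _ hi
      rw [if_neg, Matrix.zero_apply, mul_zero]
      intro h
      exact hi (hx (Subtype.ext (h.symm.trans hj.symm)))
    · simp

theorem exists_representing_atoms_of_flat {n m q k t : ℕ} {F : PolyMat n m m} {G : PolyMat n q q}
    (hG : G.IsSymm) {S : MatSeq n m} (hS : S ∈ momentCone k G) (ht : FlatAt k t F G S) :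
    ∃ (r : ℕ) (x : Fin r → feasibleSet G) (W : Fin r → Matrix (Fin m) (Fin m) ℝ),
      Function.Injective x ∧ (∀ i, (W i).PosSemidef ∧ W i ≠ 0) ∧
      (atomicMeasure x W).Represents (2 * t) S := by
  obtain ⟨-, htk, hδt, hrank⟩ := ht
  have hδ : halfDeg G ≤ flatStep G := le_max_right _ _
  -- Together with `hδ` this gives `2(t - δ) + deg G ≤ 2t`: the localizing matrix of order `t - δ`
  -- uses only moments that the atoms represent.
  have hdeg : deg G ≤ 2 * halfDeg G := by rw [halfDeg]; omega
  have hM : (momentMat t S).PosSemidef :=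
    hS.2.1.submatrix fun p : MultiIdx n t × Fin m => ((⟨p.1.1, p.1.2.trans htk⟩, p.2) :
      MultiIdx n k × Fin m)
  -- A principal submatrix, because `t ≤ k` and `δ ≥ d_G` give `t - δ ≤ k - d_G`.
  have hL : (localizingMat (t - flatStep G) G S).PosSemidef :=
    hS.2.2.submatrix fun p : MultiIdx n (t - flatStep G) × (Fin m × Fin q) =>
      ((⟨p.1.1, p.1.2.trans (by omega)⟩, p.2) : MultiIdx n (k - halfDeg G) × (Fin m × Fin q))
  obtain ⟨N, y, w, c, hrep, hc⟩ :=
    exists_rankOne_atoms_of_flat (le_max_left _ _ : 1 ≤ flatStep G) hδt S hM hrank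
  have hy : ∀ j, y j ∈ feasibleSet G := fun j =>
    posSemidef_evalAt_of_localizingMat hG y w hrep (by omega) hL j (c j) (hc j)
  have hw : ∀ j, w j ≠ 0 := by
    intro j h
    simpa [h] using hc j j
  obtain ⟨r, x, W, hx, hW, hxW⟩ := exists_distinct_atoms y hy w hw
  refine ⟨r, x, W, hx, hW, (atomicMeasure_represents_iff x W (fun i => (hW i).1) _ S).mpr ?_⟩
  intro α hα a b
  rw [hrep α hα, hxW fun z => ∏ l, z l ^ α l]

/-! ### Optimality -/

section Optimality

variable {n m q k t : ℕ} {F : PolyMat n m m} {G : PolyMat n q q} {S : MatSeq n m}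

theorem riesz_le_lamMin_of_isOptimal [Nonempty (Fin m)] (hF : F.IsSymm) (hS : IsOptimal k F G S)
    {y : Fin n → ℝ} (hy : y ∈ feasibleSet G) : riesz S F ≤ lamMin (evalAt F y) := by
  obtain ⟨v, hv, hev⟩ := exists_unit_eigenvector_lamMin (isHermitian_evalAt hF y)
  have h := hS.2 _ (pointSeq_mem_relaxFeasible k hy hv)
  rwa [riesz_pointSeq, hev, dotProduct_smul, hv, smul_eq_mul, mul_one] at h

/-- In every atomic representing measure of an optimal sequence, each atom attains the optimal
value. -/
theorem trace_mul_eq_of_isOptimal [Nonempty (Fin m)] (hF : F.IsSymm) (hS : IsOptimal k F G S)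
    {r N : ℕ} (hN : deg F ≤ N) (x : Fin r → feasibleSet G) (W : Fin r → Matrix (Fin m) (Fin m) ℝ)
    (hW : ∀ i, (W i).PosSemidef) (hrep : (atomicMeasure x W).Represents N S) (i : Fin r) :
    (evalAt F (x i) * W i).trace = riesz S F * (W i).trace := by
  rw [atomicMeasure_represents_iff x W hW] at hrep
  have h1 := riesz_one_eq_sum_trace (fun i => (x i).1) W hrep
  have h2 := riesz_eq_sum_trace F (fun i => (x i).1) W hrep hN
  have hle : ∀ i, riesz S F * (W i).trace ≤ (evalAt F (x i) * W i).trace := fun i =>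
    (mul_le_mul_of_nonneg_right (riesz_le_lamMin_of_isOptimal hF hS (x i).2)
      (hW i).trace_nonneg).trans (lamMin_mul_trace_le (isHermitian_evalAt hF _) (hW i))
  -- As the traces of the `W i` sum to `1`, both totals equal `ℒ_S(F)`; the termwise inequalities
  -- `hle` are then equalities.
  have hsum : ∑ i, riesz S F * (W i).trace = ∑ i, (evalAt F (x i) * W i).trace := by
    rw [← Finset.mul_sum, ← h1, hS.1.2, mul_one, h2]
  exact ((Finset.sum_eq_sum_iff_of_le fun i _ => hle i).mp hsum i (Finset.mem_univ i)).symm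

theorem lamMin_eq_of_isOptimal [Nonempty (Fin m)] (hF : F.IsSymm) (hS : IsOptimal k F G S)
    {r N : ℕ} (hN : deg F ≤ N) (x : Fin r → feasibleSet G) (W : Fin r → Matrix (Fin m) (Fin m) ℝ)
    (hW : ∀ i, (W i).PosSemidef) (hrep : (atomicMeasure x W).Represents N S) (i : Fin r)
    (hi : W i ≠ 0) : lamMin (evalAt F (x i)) = riesz S F := by
  refine le_antisymm ?_ (riesz_le_lamMin_of_isOptimal hF hS (x i).2)
  have hpos : 0 < (W i).trace :=
    (hW i).trace_nonneg.lt_of_ne fun h => hi ((hW i).trace_eq_zero_iff.mp h.symm)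
  refine le_of_mul_le_mul_right ?_ hpos
  rw [← trace_mul_eq_of_isOptimal hF hS hN x W hW hrep i]
  exact lamMin_mul_trace_le (isHermitian_evalAt hF _) (hW i)

/-- `F(x_i) - ℒ_S(F) I` is positive semidefinite and pairs to zero with `W i`. Its nonnegative
values at the `v l` sum to that pairing, so each vanishes and each `v l` lies in the kernel. -/
theorem mulVec_eq_of_isOptimal [Nonempty (Fin m)] (hF : F.IsSymm) (hS : IsOptimal k F G S)
    {r N : ℕ} (hN : deg F ≤ N) (x : Fin r → feasibleSet G) (W : Fin r → Matrix (Fin m) (Fin m) ℝ)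
    (hW : ∀ i, (W i).PosSemidef) (hrep : (atomicMeasure x W).Represents N S) (i : Fin r)
    {p : ℕ} (v : Fin p → Fin m → ℝ) (hv : W i = ∑ l, Matrix.vecMulVec (v l) (v l)) (l : Fin p) :
    (evalAt F (x i)).mulVec (v l) = riesz S F • v l := by
  have hpsd : (evalAt F (x i) - riesz S F • (1 : Matrix (Fin m) (Fin m) ℝ)).PosSemidef := by
    have h := (posSemidef_sub_lamMin (isHermitian_evalAt hF (x i).1)).add
      (Matrix.PosSemidef.one.smul
        (sub_nonneg.mpr (riesz_le_lamMin_of_isOptimal hF hS (x i).2)))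
    rwa [sub_smul, sub_add_sub_cancel] at h
  apply mulVec_eq_smul_of_posSemidef_sub hpsd
  have h := trace_mul_eq_of_isOptimal hF hS hN x W hW hrep i
  have hsum : ∑ l, v l ⬝ᵥ
      (evalAt F (x i) - riesz S F • (1 : Matrix (Fin m) (Fin m) ℝ)).mulVec (v l) = 0 := by
    calc _ = ((evalAt F (x i) - riesz S F • (1 : Matrix (Fin m) (Fin m) ℝ)) * W i).trace := by
          rw [hv, Matrix.mul_sum, Matrix.trace_sum]
          refine Finset.sum_congr rfl fun l _ => ?_
          rw [Matrix.mul_vecMulVec, Matrix.trace_vecMulVec, dotProduct_comm]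
      _ = 0 := by
          rw [Matrix.sub_mul, Matrix.trace_sub, h, Matrix.smul_mul, Matrix.one_mul,
            Matrix.trace_smul, smul_eq_mul, sub_self]
  exact (Finset.sum_eq_zero_iff_of_nonneg fun l _ => by
    simpa using hpsd.dotProduct_mulVec_nonneg (v l)).mp hsum l (Finset.mem_univ l)

theorem lamPrimal_eq_of_isOptimal (hS : IsOptimal k F G S) :
    lamPrimal k F G = (riesz S F : EReal) :=
  le_antisymm (iInf₂_le S hS.1) (le_iInf₂ fun S' hS' => EReal.coe_le_coe_iff.mpr (hS.2 S' hS'))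

/-- For `m = 0` every trace is zero, so the normalization rules out the case in which there is no
smallest eigenvalue. -/
theorem nonempty_fin_of_riesz_one (hS : riesz S (1 : PolyMat n m m) = 1) : Nonempty (Fin m) := by
  by_contra h
  rw [not_nonempty_iff] at h
  simp [riesz, Matrix.trace] at hS

end Optimality

end EigMoment

open EigMoment
theorem mainTheorem9 (n m q : ℕ) (F : PolyMat n m m) (G : PolyMat n q q)
    (hF : F.IsSymm) (hG : G.IsSymm)
    (k : ℕ) (hk : max (halfDeg F) (halfDeg G) ≤ k)
    (S : MatSeq n m) (hS : IsOptimal k F G S)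
    (t : ℕ) (ht : FlatAt k t F G S) :
    -- the moments of order at most `2t` have a finitely atomic representing measure on `𝒳`
    (∃ (r : ℕ) (x : Fin r → feasibleSet G) (W : Fin r → Matrix (Fin m) (Fin m) ℝ),
      Function.Injective x ∧ (∀ i, (W i).PosSemidef ∧ W i ≠ 0) ∧
      (atomicMeasure x W).Represents (2 * t) S ∧ ∑ i, (W i).trace = 1) ∧
    -- `λ*` is a real number, and it is the optimal value of the relaxation
    ∃ lam : ℝ, lamStar F G = (lam : EReal) ∧ lamPrimal k F G = (lam : EReal) ∧
      -- eigenvectors, for every measure as in the first part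
      ∀ (r : ℕ) (x : Fin r → feasibleSet G) (W : Fin r → Matrix (Fin m) (Fin m) ℝ),
        Function.Injective x → (∀ i, (W i).PosSemidef) →
        (atomicMeasure x W).Represents (2 * t) S →
        (∀ (p : Fin r → ℕ) (v : (i : Fin r) → Fin (p i) → Fin m → ℝ),
          (∀ i, W i = ∑ l, Matrix.vecMulVec (v i l) (v i l)) →
          ∀ i l, (evalAt F (x i)).mulVec (v i l) = lam • v i l) ∧
        (∀ i, W i ≠ 0 → lamMin (evalAt F (x i)) = lam) := by
  have := nonempty_fin_of_riesz_one hS.1.2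
  have hN : deg F ≤ 2 * t := by
    have h1 := ht.1
    have h2 := le_max_left (deg F) (deg G)
    omega
  obtain ⟨r, x, W, hx, hW, hrep⟩ := exists_representing_atoms_of_flat hG hS.1.1 ht
  have htr : ∑ i, (W i).trace = 1 := by
    rw [← hS.1.2]
    exact (riesz_one_eq_sum_trace (fun i => (x i).1) W
      ((atomicMeasure_represents_iff x W (fun i => (hW i).1) _ S).mp hrep)).symm
  refine ⟨⟨r, x, W, hx, hW, hrep, htr⟩, riesz S F, ?_, lamPrimal_eq_of_isOptimal hS, ?_⟩
  · refine le_antisymm ?_ (le_iInf₂ fun y hy =>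
      EReal.coe_le_coe_iff.mpr (riesz_le_lamMin_of_isOptimal hF hS hy))
    -- Total trace `1` forces at least one atom, and any atom attains the infimum defining `λ*`.
    obtain ⟨i⟩ : Nonempty (Fin r) := by
      by_contra h
      rw [not_nonempty_iff] at h
      simp at htr
    rw [← lamMin_eq_of_isOptimal hF hS hN x W (fun i => (hW i).1) hrep i (hW i).2]
    exact iInf₂_le (x i).1 (x i).2
  · exact fun r x W _ hW hrep =>
      ⟨fun p v hv i l => mulVec_eq_of_isOptimal hF hS hN x W hW hrep i (v i) (hv i) l,
        fun i hi => lamMin_eq_of_isOptimal hF hS hN x W hW hrep i hi⟩
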